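/- A Euclidean Jordan algebra (EJA) is a real Hilbert space $E$, of arbitrary (possibly infinite) dimension, with a commutative, not necessarily associative, bilinear product $*$ and a unit $1$, such that $(a*b)*(a*a)=a*(b*(a*a))$ and $\langle a*b,c\rangle=\langle b,a*c\rangle$ for all $a,b,c\in E$. Write $a\ge 0$ if $a=b*b$ for some $b\in E$, and $a\le c$ if $c-a\ge 0$. An effect is an element $q$ with $0\le q\le 1$. A linear map $f\colon E\to F$ between EJAs is positive if $a\ge 0$ implies $f(a)\ge 0$, and subunital if $f(1)\le 1$. For $a\in E$ let $L_a(b)=a*b$ and $Q_a=2L_a^2-L_{a*a}$. An idempotent $p=p*p$ is atomic if $p\neq 0$ and no nonzero idempotent is strictly below $p$; idempotents $p,p'$ are orthogonal if $p*p'=0$. The ceiling of an effect $a$ is $\lceil a\rceil=\sum_{i=1}^n p_i$ for a decomposition $a=\sum_{i=1}^n\lambda_i p_i$ with $n\ge 0$, all $\lambda_i>0$, and $p_1,\dots,p_n$ pairwise orthogonal atomic idempotents. The floor of an effect $q$ is the idempotent $\lfloor q\rfloor=1-\lceil 1-q\rceil$. For an idempotent $p$, the Peirce space $E_1(p)=Q_p(E)$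 is an EJA with the product and inner product of $E$ and unit $p$. A corner for an effect $q\in E$ is a positive subunital linear map $\pi\colon E\to C$ into an EJA $C$ with $\pi(1)=\pi(q)$, such that for every EJA $F$ and every positive subunital linear map $g\colon E\to F$ with $g(1)=g(q)$ there is a unique positive subunital linear map $\bar g\colon C\to F$ with $\bar g\circ\pi=g$. **Proposition.** Let $q$ be an effect of an EJA $E$. Then $1-q$ has a decomposition as above, so that $\lfloor q\rfloor$ is defined, and the map $\pi_q=r\circ Q_{\lfloor q\rfloor}\colon E\to E_1(\lfloor q\rfloor)$, where $r\colon E\to E_1(\lfloor q\rfloor)$ is the orthogonal projection, is a corner for $q$. -/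

import Mathlib

/-- A Euclidean Jordan algebra, of arbitrary dimension: a real Hilbert space with a commutative,
not necessarily associative, bilinear product `*` and a unit `1`, satisfying the Jordan identity,
such that multiplication operators are symmetric for the inner product. -/
class EuclideanJordanAlgebra (E : Type*) [NormedAddCommGroup E] [InnerProductSpace ℝ E]
    extends Mul E, One E where
  complete : CompleteSpace E
  mul_comm' : ∀ a b : E, a * b = b * a
  one_mul' : ∀ a : E, 1 * a = a
  mul_add' : ∀ a b c : E, a * (b + c) = a * b + a * c
  mul_smul' : ∀ (t : ℝ) (a b : E), a * (t • b) = t • (a * b)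
  jordan : ∀ a b : E, (a * b) * (a * a) = a * (b * (a * a))
  inner_mul : ∀ a b c : E, inner ℝ (a * b) c = inner ℝ b (a * c)

namespace EuclideanJordanAlgebra

section Basic

variable {E : Type*} [NormedAddCommGroup E] [InnerProductSpace ℝ E] [EuclideanJordanAlgebra E]

/-- The underlying commutative non-associative ring. -/
instance toNonUnitalNonAssocCommRing : NonUnitalNonAssocCommRing E where
  left_distrib := mul_add'
  right_distrib a b c := by
    rw [mul_comm' (a + b) c, mul_add', mul_comm' c a, mul_comm' c b]
  zero_mul a := by
    have h := mul_smul' (0 : ℝ) a (0 : E)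
    rw [mul_comm']
    simpa only [zero_smul] using h
  mul_zero a := by
    have h := mul_smul' (0 : ℝ) a (0 : E)
    simpa only [zero_smul] using h
  mul_comm := mul_comm'

instance toIsCommJordan : IsCommJordan E where
  lmul_comm_rmul_rmul := jordan

/-- `a ≥ 0`: the element `a` is a square. -/
def IsPositive (a : E) : Prop := ∃ b : E, a = b * b

/-- The relation `a ≤ c`, that is, `c - a ≥ 0`. -/
def Le (a c : E) : Prop := IsPositive (c - a)

/-- An effect: an element `a` with `0 ≤ a ≤ 1`. -/
def IsEffect (a : E) : Prop := Le 0 a ∧ Le a 1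

/-- The multiplication operator `L_a : b ↦ a * b`. -/
def L (a : E) : E →ₗ[ℝ] E where
  toFun b := a * b
  map_add' := mul_add' a
  map_smul' t b := mul_smul' t a b

/-- The quadratic representation `Q_a = 2 L_a² - L_{a²}`. -/
def Q (a : E) : E →ₗ[ℝ] E := (2 : ℝ) • (L a ∘ₗ L a) - L (a * a)

variable (E) in
/-- The idempotents of `E`. -/
def Idempotent : Type _ := {p : E // p * p = p}

/-- An atomic idempotent: a nonzero idempotent with no nonzero idempotent strictly below it. -/
def IsAtomic (p : E) : Prop :=
  p * p = p ∧ p ≠ 0 ∧ ∀ r : E, r * r = r → Le r p → r ≠ p → r = 0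

/-- `c = ∑ i, p i` for some decomposition `a = ∑ i, t i • p i` with all `t i > 0` and
pairwise orthogonal atomic idempotents `p i`. -/
def IsCeil (a c : E) : Prop :=
  ∃ (n : ℕ) (t : Fin n → ℝ) (p : Fin n → E),
    (∀ i, 0 < t i) ∧ (∀ i, IsAtomic (p i)) ∧ (∀ i j, i ≠ j → p i * p j = 0) ∧
    a = ∑ i, t i • p i ∧ c = ∑ i, p i

theorem IsCeil.idempotent {a c : E} (h : IsCeil a c) : c * c = c := by
  obtain ⟨n, t, p, -, hp, ho, -, rfl⟩ := h
  rw [Finset.sum_mul]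
  refine Finset.sum_congr rfl fun i _ => ?_
  rw [Finset.mul_sum, Finset.sum_eq_single i]
  · exact (hp i).1
  · intro j _ hj
    exact ho i j hj.symm
  · simp

open Classical in
/-- The ceiling `⌈a⌉` of an effect `a` (with the value `0` if `a` had no decomposition). -/
noncomputable def ceil (a : E) : E := if h : ∃ c : E, IsCeil a c then h.choose else 0

theorem ceil_idempotent (a : E) : ceil a * ceil a = ceil a := by
  unfold ceil
  split_ifs with h
  · exact h.choose_spec.idempotent
  · exact zero_mul 0

/-- The floor `⌊a⌋ = 1 - ⌈1 - a⌉`, an idempotent. -/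
noncomputable def floor (a : E) : Idempotent E :=
  ⟨1 - ceil (1 - a), by
    have h1 : ∀ x : E, 1 * x = x := one_mul'
    have h2 : ∀ x : E, x * 1 = x := fun x => by rw [mul_comm, h1]
    rw [sub_mul, mul_sub, mul_sub, h1, h1, h2, ceil_idempotent, sub_self, sub_zero]⟩

/-! ### The Peirce space of an idempotent -/

/-- The Peirce space `E_1(p) = Q_p(E)`. -/
def peirceOne (p : Idempotent E) : Submodule ℝ E := LinearMap.range (Q p.1)

/-- The linearised Jordan identity. -/
theorem linearised (a b c d : E) :
    a * ((b * c) * d) + b * ((c * a) * d) + c * ((a * b) * d)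
      = (b * c) * (a * d) + (c * a) * (b * d) + (a * b) * (c * d) := by
  have h := congrArg (fun f : AddMonoid.End E => f d)
    (two_nsmul_lie_lmul_lmul_add_add_eq_zero a b c)
  simp only [Ring.lie_def, nsmul_eq_mul] at h
  have h' : (2 : ℝ) • (a * ((b * c) * d) - (b * c) * (a * d) + (b * ((c * a) * d)
      - (c * a) * (b * d)) + (c * ((a * b) * d) - (a * b) * (c * d))) = 0 := by
    rw [two_smul]
    rw [← nsmul_eq_mul, two_nsmul] at h
    exact h
  have h3 := (smul_eq_zero.1 h').resolve_left two_ne_zero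
  rw [← sub_eq_zero, ← h3]
  abel

/-- `2 L_p³ - 3 L_p² + L_p = 0` for an idempotent `p`. -/
theorem idempotent_cubic {p : E} (hp : p * p = p) (x : E) :
    (2 : ℝ) • (p * (p * (p * x))) - (3 : ℝ) • (p * (p * x)) + p * x = 0 := by
  have h := linearised p x p p
  rw [mul_comm x p, hp, mul_comm (p * x) p, mul_comm x (p * p), hp] at h
  have e : (2 : ℝ) • (p * (p * (p * x))) + p * x - (3 : ℝ) • (p * (p * x)) = 0 := by
    rw [two_smul, show (3 : ℝ) = 1 + 1 + 1 by norm_num, add_smul, add_smul, one_smul, sub_eq_zero]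
    calc _ = p * (p * (p * x)) + p * x + p * (p * (p * x)) := by abel
      _ = _ := by
        rw [← sub_eq_zero] at h ⊢
        rw [← h]
  rw [← e]
  abel

theorem mem_peirceOne_iff {p : Idempotent E} {x : E} : x ∈ peirceOne p ↔ p.1 * x = x := by
  constructor
  · rintro ⟨y, rfl⟩
    have h := idempotent_cubic p.2 y
    have h' : p.1 * Q p.1 y = (2 : ℝ) • (p.1 * (p.1 * (p.1 * y))) - p.1 * (p.1 * y) := by
      change p.1 * ((2 : ℝ) • (p.1 * (p.1 * y)) - (p.1 * p.1) * y) = _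
      rw [p.2, mul_sub, mul_smul']
    rw [h', ← sub_eq_zero]
    change _ - ((2 : ℝ) • (p.1 * (p.1 * y)) - (p.1 * p.1) * y) = 0
    rw [p.2, ← h, show (3 : ℝ) = 2 + 1 by norm_num, add_smul, one_smul]
    abel
  · intro h
    refine ⟨x, ?_⟩
    change (2 : ℝ) • (p.1 * (p.1 * x)) - (p.1 * p.1) * x = x
    rw [p.2, h, h, two_smul, add_sub_cancel_right]

theorem mul_mem_peirceOne {p : Idempotent E} {x y : E} (hx : x ∈ peirceOne p)
    (hy : y ∈ peirceOne p) : x * y ∈ peirceOne p := by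
  rw [mem_peirceOne_iff] at *
  have h := linearised p.1 p.1 x y
  rw [mul_comm x p.1, hx, hy, p.2, hy, add_assoc, add_assoc] at h
  exact add_right_cancel (b := p.1 * (x * y) + x * y) (by
    rw [h, add_comm (x * y) (p.1 * (x * y))])

theorem self_mem_peirceOne (p : Idempotent E) : p.1 ∈ peirceOne p := mem_peirceOne_iff.2 p.2

theorem isComplete_peirceOne (p : Idempotent E) : CompleteSpace (peirceOne p) := by
  have : CompleteSpace E := EuclideanJordanAlgebra.complete
  have hL : Continuous (L p.1) :=
    LinearMap.IsSymmetric.continuous (T := L p.1) fun x y => inner_mul p.1 x y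
  have hs : (peirceOne p : Set E) = {x | L p.1 x = x} := by
    ext x
    exact mem_peirceOne_iff
  have hc : IsClosed (peirceOne p : Set E) := by
    rw [hs]
    exact isClosed_eq hL continuous_id
  exact hc.completeSpace_coe

/-- `E_1(p)` is a Euclidean Jordan algebra: the inner product and the product are
restricted from `E`, and the unit is `p`. -/
instance peirceOneEJA (p : Idempotent E) : EuclideanJordanAlgebra (peirceOne p) where
  mul x y := ⟨x.1 * y.1, mul_mem_peirceOne x.2 y.2⟩
  one := ⟨p.1, self_mem_peirceOne p⟩
  complete := isComplete_peirceOne p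
  mul_comm' x y := Subtype.ext (mul_comm' x.1 y.1)
  one_mul' x := Subtype.ext (mem_peirceOne_iff.1 x.2)
  mul_add' x y z := Subtype.ext (mul_add' x.1 y.1 z.1)
  mul_smul' t x y := Subtype.ext (mul_smul' t x.1 y.1)
  jordan x y := Subtype.ext (jordan x.1 y.1)
  inner_mul x y z := inner_mul x.1 y.1 z.1

instance completeSpace_peirceOne (p : Idempotent E) : CompleteSpace (peirceOne p) :=
  isComplete_peirceOne p

/-- The map `π_q = r ∘ Q_{⌊q⌋} : E → E_1(⌊q⌋)`, where `r` is the orthogonal projection. -/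
noncomputable def standardCorner (q : E) : E →ₗ[ℝ] peirceOne (floor q) :=
  (peirceOne (floor q)).orthogonalProjectionOnto.toLinearMap ∘ₗ Q (floor q).1

end Basic

/-- Positive subunital maps: linear maps sending positive elements to positive elements and
with `f 1 ≤ 1`. These are the morphisms of the category of Euclidean Jordan algebras. -/
def IsPSU {E F : Type*} [NormedAddCommGroup E] [InnerProductSpace ℝ E] [EuclideanJordanAlgebra E]
    [NormedAddCommGroup F] [InnerProductSpace ℝ F] [EuclideanJordanAlgebra F]
    (f : E →ₗ[ℝ] F) : Prop :=
  (∀ a : E, IsPositive a → IsPositive (f a)) ∧ Le (f 1) 1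

/-- `π : E → C` is a corner for `q`: it is positive and subunital with `π 1 = π q`, and every
positive subunital `g : E → F` with `g 1 = g q` factors as `h ∘ π` for a unique positive subunital
`h : C → F`. -/
def IsCorner.{u, v, w} {E : Type u} {C : Type v}
    [NormedAddCommGroup E] [InnerProductSpace ℝ E] [EuclideanJordanAlgebra E]
    [NormedAddCommGroup C] [InnerProductSpace ℝ C] [EuclideanJordanAlgebra C]
    (q : E) (π : E →ₗ[ℝ] C) : Prop :=
  IsPSU π ∧ π 1 = π q ∧
    ∀ (F : Type w) [NormedAddCommGroup F] [InnerProductSpace ℝ F] [EuclideanJordanAlgebra F]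
      (g : E →ₗ[ℝ] F), IsPSU g → g 1 = g q →
        ∃! h : C →ₗ[ℝ] F, IsPSU h ∧ h ∘ₗ π = g

end EuclideanJordanAlgebra

universe u w

namespace EuclideanJordanAlgebra

section Algebra

variable {E : Type*} [NormedAddCommGroup E] [InnerProductSpace ℝ E] [EuclideanJordanAlgebra E]

/-! Write `p = ⌊q⌋` and `c = 1 - p = ⌈1 - q⌉`. If `g` is positive and `g 1 = g q`, then `g` kills `1
- q`, hence each atom in its decomposition, hence `c`. A Cauchy–Schwarz type argument
(`map_mul_eq_zero`) then gives `g (c * y) = 0` for all `y`, so `g ∘ Q_p = g` (`map_Q_floor`). The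
factor is `g` restricted to `E_1(p)`, unique because `π_q` fixes `E_1(p)`. Positivity of `π_q`
follows from self-duality of the cone (`isPositive_iff`) and symmetry of `Q_p`. Self-duality rests
on the finite spectral theorem. In infinite dimension its eigenvectors come from power iteration:
after scaling by the spectral radius, even powers converge to a nonzero idempotent. Splitting off
atoms stops because the product is bounded: nonzero idempotents have norms bounded below, while
orthogonal families fit under `‖1‖²`. -/

instance isScalarTower : IsScalarTower ℝ E E where
  smul_assoc t a b := by
    rw [smul_eq_mul, smul_eq_mul, mul_comm, mul_smul', mul_comm]

instance smulCommClass : SMulCommClass ℝ E E where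
  smul_comm t a b := (mul_smul' t a b).symm

theorem one_mul_eq (a : E) : 1 * a = a := one_mul' a

theorem mul_one_eq (a : E) : a * 1 = a := by rw [mul_comm, one_mul_eq]

theorem inner_mul_left (a b c : E) : inner ℝ (a * b) c = inner ℝ b (a * c) := inner_mul a b c

@[simp] theorem L_apply (a b : E) : L a b = a * b := rfl

theorem Q_apply (a b : E) : Q a b = (2 : ℝ) • (a * (a * b)) - (a * a) * b := rfl

theorem inner_mul_self_one (a : E) : inner ℝ (a * a) 1 = ‖a‖ ^ 2 := by
  rw [inner_mul_left, mul_one_eq, real_inner_self_eq_norm_sq]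

theorem inner_one_of_idempotent {p : E} (hp : p * p = p) : inner ℝ p 1 = ‖p‖ ^ 2 := by
  rw [← inner_mul_self_one, hp]

/-! ### Peirce relations -/

theorem peirce_zero_mul_zero {p x y : E} (hp : p * p = p) (hx : p * x = 0) (hy : p * y = 0) :
    p * (x * y) = 0 := by
  have h := linearised p p x y
  rw [mul_comm x p, hx, hy, hp, hy] at h
  simpa using h.symm

theorem peirce_zero_mul_one {p x y : E} (hp : p * p = p) (hx : p * x = 0) (hy : p * y = y) :
    x * y = 0 := by
  have h1 := linearised p p x y
  have h2 := linearised p p y x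
  rw [mul_comm x p, hx, hp, hy] at h1
  rw [mul_comm y p, hy, hp, hx] at h2
  simp only [zero_mul, mul_zero, zero_add, add_zero] at h1 h2
  rw [h1, mul_comm x y]
  simpa using h2

/-- With Peirce components `b₁`, `b_{1/2}`, `b₀`, both sides equal `‖b₁‖² + ½‖b_{1/2}‖²`. The proof
pairs the cubic for `L_p` with `b` and `p * b`. -/
theorem inner_mul_self_of_idempotent {p : E} (hp : p * p = p) (b : E) :
    inner ℝ p (b * b) = ‖p * b‖ ^ 2 + 4 * ‖p * (p * b) - p * b‖ ^ 2 := by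
  have h0 : inner ℝ p (b * b) = inner ℝ (p * b) b := by
    rw [mul_comm p b, inner_mul_left]
  have h3 : inner ℝ (p * (p * (p * b))) (p * b) = inner ℝ (p * (p * b)) (p * (p * b)) :=
    inner_mul_left _ _ _
  have h2 : inner ℝ (p * (p * b)) (p * b) = inner ℝ (p * (p * (p * b))) b := by
    rw [inner_mul_left p (p * (p * b)), inner_mul_left p (p * b)]
  have h1 : inner ℝ (p * b) (p * b) = inner ℝ (p * (p * b)) b := by
    rw [inner_mul_left p (p * b)]
  have c1 := congrArg (fun v => inner ℝ v b) (idempotent_cubic hp b)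
  have c2 := congrArg (fun v => inner ℝ v (p * b)) (idempotent_cubic hp b)
  simp only [inner_add_left, inner_sub_left, real_inner_smul_left, inner_zero_left] at c1 c2
  rw [h0, norm_sub_sq_real, ← real_inner_self_eq_norm_sq, ← real_inner_self_eq_norm_sq]
  linarith

theorem inner_idempotent_nonneg {p a : E} (hp : p * p = p) (ha : IsPositive a) :
    0 ≤ inner ℝ p a := by
  obtain ⟨b, rfl⟩ := ha
  rw [inner_mul_self_of_idempotent hp]
  positivity

theorem one_sub_idempotent {p : E} (hp : p * p = p) : (1 - p) * (1 - p) = 1 - p := by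
  rw [sub_mul, mul_sub, mul_sub, one_mul_eq, one_mul_eq, mul_one_eq, hp, sub_self, sub_zero]

theorem mul_eq_of_le {p r : E} (hp : p * p = p) (hr : r * r = r) (h : Le r p) : p * r = r := by
  have h1 : 0 ≤ inner ℝ (1 - p) (p - r) := inner_idempotent_nonneg (one_sub_idempotent hp) h
  have h2 : inner ℝ (1 - p) p = 0 := by
    nth_rw 2 [← hp]
    rw [← inner_mul_left, mul_sub, mul_one_eq, hp, sub_self, inner_zero_left]
  have h3 := inner_mul_self_of_idempotent (one_sub_idempotent hp) r
  rw [hr] at h3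
  rw [inner_sub_right, h2] at h1
  -- `⟨1 - p, r⟩` is at most `0`, yet by `h3` it is a sum of squares.
  have h4 : ‖(1 - p) * r‖ ^ 2 = 0 :=
    le_antisymm (by nlinarith [sq_nonneg ‖(1 - p) * ((1 - p) * r) - (1 - p) * r‖]) (sq_nonneg _)
  have h5 : (1 - p) * r = 0 := by simpa using h4
  rw [sub_mul, one_mul_eq, sub_eq_zero] at h5
  exact h5.symm

/-! ### Powers -/

/-- The `n`-th power of `x`. -/
def power (x : E) (n : ℕ) : E := (L x ^ n) 1

@[simp] theorem power_zero (x : E) : power x 0 = 1 := by simp [power]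

theorem power_succ (x : E) (n : ℕ) : power x (n + 1) = x * power x n := by
  simp [power, pow_succ']

theorem power_one (x : E) : power x 1 = x := by
  rw [power_succ, power_zero, mul_one_eq]

theorem commute_L_sq (x : E) : Commute (L x) (L (x * x)) := by
  refine LinearMap.ext fun b => ?_
  have h := jordan x b
  simp only [Module.End.mul_apply, L_apply]
  rw [mul_comm (x * x) b, ← h, mul_comm]

theorem sq_mul_power (x : E) (n : ℕ) : (x * x) * power x n = power x (n + 2) := by
  have h := congrArg (fun f : E →ₗ[ℝ] E => f 1) ((commute_L_sq x).pow_left n).eq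
  simp only [Module.End.mul_apply, L_apply, mul_one_eq] at h
  rw [power, ← h, power, pow_add, Module.End.mul_apply, pow_two, Module.End.mul_apply, L_apply,
    L_apply, mul_one_eq]

theorem L_sq_mul (x y : E) :
    L (x * x * y) = L (x * y) * L x + L (x * y) * L x + L (x * x) * L y
      - (L x * L y * L x + L x * L y * L x) := by
  refine LinearMap.ext fun c => ?_
  have h := linearised x x c y
  rw [mul_comm c x, mul_comm c (x * x * y)] at h
  simp only [Module.End.mul_apply, LinearMap.add_apply, LinearMap.sub_apply, L_apply]
  rw [eq_sub_iff_add_eq, mul_comm (x * y) (x * c), mul_comm y (x * c), mul_comm y c, ← h]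
  abel

/-- `L_sq_mul` writes the operator of the power `n + 2` through `L x`, `L (x * x)` and those of the
two preceding powers. -/
theorem commute_L_power (x : E) (n : ℕ) : Commute (L x) (L (power x n)) := by
  induction n using Nat.twoStepInduction with
  | zero =>
    have : L (1 : E) = 1 := LinearMap.ext fun b => one_mul_eq b
    rw [power_zero, this]
    exact Commute.one_right _
  | one => rw [power_one]
  | more n h0 h1 =>
    have hx := Commute.refl (L x)
    rw [← sq_mul_power, L_sq_mul, ← power_succ]
    have h2 := h1.mul_right hx
    have h3 := (hx.mul_right h0).mul_right hx
    exact ((h2.add_right h2).add_right ((commute_L_sq x).mul_right h0)).sub_right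
      (h3.add_right h3)

theorem power_mul_power (x : E) (m n : ℕ) : power x m * power x n = power x (m + n) := by
  have h := congrArg (fun f : E →ₗ[ℝ] E => f 1) ((commute_L_power x n).pow_left m).eq
  simp only [Module.End.mul_apply, L_apply, mul_one_eq] at h
  have h' : power x n * power x m = (L x ^ m) (power x n) := h.symm
  rw [mul_comm, h', power, power, pow_add, Module.End.mul_apply]

theorem smul_power (t : ℝ) (x : E) (n : ℕ) : power (t • x) n = t ^ n • power x n := by
  induction n with
  | zero => simp
  | succ n ih =>
    rw [power_succ, ih, power_succ, smul_mul_assoc, mul_smul_comm, smul_smul, pow_succ']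

theorem inner_power_power (x : E) (m n : ℕ) :
    inner ℝ (power x m) (power x n) = inner ℝ (power x (m + n)) 1 := by
  rw [← power_mul_power, inner_mul_left, mul_one_eq, real_inner_comm]

theorem mul_power_eq_zero {p x : E} (hp : p * p = p) (hx : p * x = 0) (n : ℕ) :
    p * power x (n + 1) = 0 := by
  induction n with
  | zero => rwa [power_one]
  | succ n ih =>
    rw [power_succ]
    exact peirce_zero_mul_zero hp hx ih

/-! ### Boundedness of the product -/

/-- The multiplication operator as a continuous linear map. -/
noncomputable def continuousL (a : E) : E →L[ℝ] E where
  toLinearMap := L a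
  cont := by
    have : CompleteSpace E := EuclideanJordanAlgebra.complete
    exact LinearMap.IsSymmetric.continuous (T := L a) fun x y => inner_mul a x y

theorem continuousL_apply (a b : E) : continuousL a b = a * b := rfl

variable (E) in
-- Each `L a` is bounded by Hellinger–Toeplitz; commutativity turns this into the pointwise bounds
-- needed for uniform boundedness.
theorem exists_norm_mul_le : ∃ C : ℝ, 0 < C ∧ ∀ a b : E, ‖a * b‖ ≤ C * ‖a‖ * ‖b‖ := by
  have : CompleteSpace E := EuclideanJordanAlgebra.complete
  obtain ⟨C, hC⟩ := banach_steinhaus (g := fun a : Metric.closedBall (0 : E) 1 =>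
    continuousL a.1) fun b => ⟨‖continuousL b‖, fun a => by
      rw [continuousL_apply, mul_comm, ← continuousL_apply]
      exact (continuousL b).unit_le_opNorm _ (mem_closedBall_zero_iff.1 a.2)⟩
  have hC0 : 0 ≤ C := (norm_nonneg _).trans (hC ⟨0, by simp⟩)
  refine ⟨C + 1, by linarith, fun a b => ?_⟩
  rcases eq_or_ne a 0 with rfl | ha
  · simp
  have ha' : 0 < ‖a‖ := norm_pos_iff.2 ha
  have h := (continuousL (‖a‖⁻¹ • a)).le_of_opNorm_le
    (hC ⟨‖a‖⁻¹ • a, by simp [norm_smul, ha'.ne']⟩) b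
  rw [continuousL_apply, smul_mul_assoc, norm_smul, norm_inv, norm_norm, inv_mul_le_iff₀ ha'] at h
  nlinarith [mul_nonneg ha'.le (norm_nonneg b)]

theorem continuous_mul_pair : Continuous fun z : E × E => z.1 * z.2 := by
  obtain ⟨C, -, hC⟩ := exists_norm_mul_le E
  exact (LinearMap.mkContinuous₂ (LinearMap.mk₂ ℝ (fun a b : E => a * b) add_mul smul_mul_assoc
    mul_add fun t a b => mul_smul_comm t a b) C hC).continuous₂

instance continuousMul : ContinuousMul E := ⟨continuous_mul_pair⟩

/-! ### Limits of powers -/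

/-- Inner products of powers depend only on the sum of exponents, so distances between even powers
are second differences of the convergent sequence `‖yⁿ‖²`. Odd powers are left out because an
eigenvalue `-1` would make the full sequence oscillate. -/
theorem exists_tendsto_power {y : E} (hy : ∀ n, ‖power y (n + 1)‖ ≤ ‖power y n‖) :
    ∃ e : E, Filter.Tendsto (fun n => power y (2 * n)) Filter.atTop (nhds e) := by
  have : CompleteSpace E := EuclideanJordanAlgebra.complete
  let m : ℕ → ℝ := fun n => ‖power y n‖ ^ 2
  have hm : Antitone m := antitone_nat_of_succ_le fun n =>
    pow_le_pow_left₀ (norm_nonneg _) (hy n) 2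
  have hin : ∀ i j k, i + j = 2 * k → inner ℝ (power y i) (power y j) = m k := fun i j k h => by
    rw [inner_power_power, h, two_mul, ← power_mul_power, inner_mul_self_one]
  have hb : BddBelow (Set.range m) := ⟨0, by rintro _ ⟨n, rfl⟩; positivity⟩
  have hlim := tendsto_atTop_ciInf hm hb
  have hlim2 : Filter.Tendsto (fun n => √(m (2 * n) - ⨅ i, m i)) Filter.atTop (nhds 0) := by
    have h2 : Filter.Tendsto (fun n : ℕ => 2 * n) Filter.atTop Filter.atTop :=
      Filter.tendsto_id.const_mul_atTop' two_pos
    have := ((hlim.comp h2).sub_const (⨅ i, m i)).sqrt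
    simpa using this
  refine cauchySeq_tendsto_of_complete
    (cauchySeq_of_le_tendsto_0' _ (fun n l hnl => ?_) hlim2)
  refine Real.le_sqrt_of_sq_le ?_
  rw [dist_eq_norm, norm_sub_sq_real, hin _ _ (n + l) (by ring)]
  have h1 : m (2 * l) ≤ m (n + l) := hm (by lia)
  have h2 : ⨅ i, m i ≤ m (2 * l) := ciInf_le hb _
  change m (2 * n) - 2 * m (n + l) + m (2 * l) ≤ _
  linarith

/-- Cauchy–Schwarz makes `‖xⁿ‖` log-convex, so successive ratios increase; `s` is their supremum.
The lower bound later keeps the limit of powers away from `0`. -/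
theorem exists_spectral_radius {C : ℝ} (hC : ∀ a b : E, ‖a * b‖ ≤ C * ‖a‖ * ‖b‖)
    {x : E} (hx : x ≠ 0) :
    ∃ s : ℝ, 0 < s ∧ ∀ n, ‖power x (n + 1)‖ ≤ s * ‖power x n‖ ∧ s ^ n ≤ C * ‖power x n‖ := by
  let u : ℕ → ℝ := fun n => ‖power x n‖
  have hlog : ∀ n, u (n + 1) ^ 2 ≤ u n * u (n + 2) := fun n => by
    have h := real_inner_le_norm (power x n) (power x (n + 2))
    rwa [inner_power_power, show n + (n + 2) = (n + 1) + (n + 1) by ring, ← inner_power_power,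
      real_inner_self_eq_norm_sq] at h
  have hu1 : 0 < u 1 := by simpa [u, power_one] using hx
  have hpos : ∀ n, 0 < u n ∧ 0 < u (n + 1) := fun n => by
    induction n with
    | zero =>
      refine ⟨(norm_nonneg _).lt_of_ne fun h => hx ?_, hu1⟩
      have : (1 : E) = 0 := by simpa using h.symm
      rw [← one_mul_eq x, this, zero_mul]
    | succ n ih =>
      refine ⟨ih.2, (norm_nonneg _).lt_of_ne fun h => ?_⟩
      have h1 := hlog n
      have h2 : u (n + 2) = 0 := h.symm
      rw [h2, mul_zero] at h1
      nlinarith [ih.2]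
  let r : ℕ → ℝ := fun n => u (n + 1) / u n
  have hr : Monotone r := monotone_nat_of_le_succ fun n => by
    rw [div_le_div_iff₀ (hpos n).1 (hpos n).2]
    linarith [hlog n]
  have hb : BddAbove (Set.range r) := ⟨C * ‖x‖, by
    rintro _ ⟨n, rfl⟩
    rw [div_le_iff₀ (hpos n).1]
    simpa only [u, power_succ] using hC x (power x n)⟩
  have hs : ∀ n, r n ≤ ⨆ i, r i := le_ciSup hb
  refine ⟨⨆ i, r i, (div_pos (hpos 0).2 (hpos 0).1).trans_le (hs 0), fun n => ⟨?_, ?_⟩⟩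
  · exact (div_le_iff₀ (hpos n).1).1 (hs n)
  · refine le_of_tendsto' ((tendsto_atTop_ciSup hr hb).pow n) fun m => ?_
    have h1 : ∀ k, r m ^ k * u m ≤ u (m + k) := fun k => by
      induction k with
      | zero => simp
      | succ k ih =>
        have h2 : r m ≤ r (m + k) := hr (by lia)
        have h3 : 0 ≤ r m := div_nonneg (norm_nonneg _) (norm_nonneg _)
        calc r m ^ (k + 1) * u m = r m * (r m ^ k * u m) := by ring
          _ ≤ r (m + k) * u (m + k) := by gcongr
          _ = u (m + (k + 1)) := div_mul_cancel₀ _ (hpos _).1.ne'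
    have h4 : u (m + n) ≤ C * u n * u m := by
      have := hC (power x n) (power x m)
      rwa [power_mul_power, add_comm] at this
    exact le_of_mul_le_mul_right ((h1 n).trans h4) (hpos m).1

/-- Every nonzero element has an idempotent eigenvector for a nonzero eigenvalue, lying in the
closed algebra that the element generates. -/
theorem exists_idempotent_eigenvector {x : E} (hx : x ≠ 0) :
    ∃ (t : ℝ) (e : E), t ≠ 0 ∧ e ≠ 0 ∧ e * e = e ∧ x * e = t • e ∧
      ∀ p : E, p * p = p → p * x = 0 → p * e = 0 := by
  obtain ⟨C, -, hC⟩ := exists_norm_mul_le E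
  obtain ⟨s, hs, h⟩ := exists_spectral_radius hC hx
  obtain ⟨y, rfl⟩ : ∃ y, x = s • y := ⟨s⁻¹ • x, by rw [smul_inv_smul₀ hs.ne']⟩
  simp only [smul_power, norm_smul, norm_pow, Real.norm_of_nonneg hs.le] at h
  have hy : ∀ n, ‖power y (n + 1)‖ ≤ ‖power y n‖ := fun n => by
    have := (h n).1
    rw [← mul_assoc, ← pow_succ'] at this
    exact le_of_mul_le_mul_left this (by positivity)
  have hy' : ∀ n, 1 ≤ C * ‖power y n‖ := fun n => by
    have := (h n).2
    exact le_of_mul_le_mul_left (a := s ^ n) (by linarith) (by positivity)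
  obtain ⟨e, he⟩ := exists_tendsto_power hy
  have hf : Filter.Tendsto (fun n => power y (2 * n + 1)) Filter.atTop (nhds (y * e)) := by
    simpa only [power_succ] using he.const_mul y
  have h2 : Filter.Tendsto (fun n : ℕ => 2 * n) Filter.atTop Filter.atTop :=
    Filter.tendsto_id.const_mul_atTop' two_pos
  have h1 : Filter.Tendsto (fun n : ℕ => n + 1) Filter.atTop Filter.atTop :=
    Filter.tendsto_add_atTop_nat 1
  have hee : e * e = e := by
    refine tendsto_nhds_unique (he.mul he) ((he.comp h2).congr fun n => ?_)
    rw [power_mul_power, Function.comp_apply, ← two_mul]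
  have hyy : y * (y * e) = e := by
    refine tendsto_nhds_unique (hf.const_mul y) ((he.comp h1).congr fun n => ?_)
    rw [← power_succ]
    rfl
  have hef : e * (y * e) = y * e := by
    refine tendsto_nhds_unique (he.mul hf) ((hf.comp h2).congr fun n => ?_)
    rw [power_mul_power, Function.comp_apply]
    congr 1
    ring
  have hff : (y * e) * (y * e) = e := by
    refine tendsto_nhds_unique (hf.mul hf) (((he.comp h1).comp h2).congr fun n => ?_)
    rw [power_mul_power, Function.comp_apply, Function.comp_apply]
    congr 1
    ring
  have he0 : e ≠ 0 := by
    rintro rfl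
    have := ge_of_tendsto' (he.norm.const_mul C) fun n => hy' (2 * n)
    simp at this
    linarith
  have hp : ∀ p : E, p * p = p → p * (s • y) = 0 → p * e = 0 ∧ p * (y * e) = 0 := by
    intro p hpp hpy
    have hpy' : p * y = 0 := by
      rw [mul_smul_comm] at hpy
      exact (smul_eq_zero.1 hpy).resolve_left hs.ne'
    have hpe : p * e = 0 := by
      refine tendsto_nhds_unique ((he.comp h1).const_mul p) (tendsto_const_nhds.congr fun n => ?_)
      exact (mul_power_eq_zero hpp hpy' (2 * n + 1)).symm
    exact ⟨hpe, peirce_zero_mul_zero hpp hpy' hpe⟩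
  set f := y * e with hfdef
  -- Since `e² = f² = e` and `e * f = f`, the elements `(e ± f)/2` are idempotent eigenvectors of
  -- `y` for `±1`. If the plus one vanishes, `e` itself has eigenvalue `-1`.
  by_cases hef0 : e + f = 0
  · refine ⟨-s, e, neg_ne_zero.2 hs.ne', he0, hee, ?_, fun p h3 h4 => (hp p h3 h4).1⟩
    rw [smul_mul_assoc, ← hfdef, neg_smul, ← smul_neg, eq_neg_of_add_eq_zero_right hef0]
  · refine ⟨s, (2 : ℝ)⁻¹ • (e + f), hs.ne', smul_ne_zero (by norm_num) hef0, ?_, ?_, fun p h3 h4 => ?_⟩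
    · rw [smul_mul_assoc, mul_smul_comm, add_mul, mul_add, mul_add, hee, hef, mul_comm f e, hef,
        hff, add_comm f e, ← two_smul ℝ (e + f), inv_smul_smul₀ two_ne_zero]
    · rw [smul_mul_assoc, mul_smul_comm, mul_add, ← hfdef, hyy, add_comm f e]
    · rw [mul_smul_comm, mul_add, (hp p h3 h4).1, (hp p h3 h4).2, add_zero, smul_zero]

end Algebra

section Spectral

variable {E : Type*} [NormedAddCommGroup E] [InnerProductSpace ℝ E] [EuclideanJordanAlgebra E]

/-! ### Spectral decompositions -/

theorem one_le_mul_norm_of_idempotent {C : ℝ} (hC : ∀ a b : E, ‖a * b‖ ≤ C * ‖a‖ * ‖b‖) {p : E}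
    (hp : p * p = p) (h0 : p ≠ 0) : 1 ≤ C * ‖p‖ := by
  have h := hC p p
  rw [hp] at h
  exact le_of_mul_le_mul_right (by linarith) (norm_pos_iff.2 h0)

/-- Replacing `e` by a proper nonzero subidempotent lowers `C² * ‖e‖²` by at least `1`, by
Pythagoras, so descent terminates. -/
theorem exists_atomic_below {e : E} (he : e * e = e) (h0 : e ≠ 0) :
    ∃ r : E, IsAtomic r ∧ e * r = r := by
  obtain ⟨C, hC0, hC⟩ := exists_norm_mul_le E
  obtain ⟨N, hN⟩ := exists_nat_ge (C ^ 2 * ‖e‖ ^ 2)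
  induction N generalizing e with
  | zero =>
    have := one_le_mul_norm_of_idempotent hC he h0
    rw [← mul_pow, Nat.cast_zero] at hN
    nlinarith
  | succ N ih =>
    by_cases hat : IsAtomic e
    · exact ⟨e, hat, he⟩
    obtain ⟨r, hr, hle, hne, hr0⟩ : ∃ r : E, r * r = r ∧ Le r e ∧ r ≠ e ∧ r ≠ 0 := by
      by_contra! hcon
      exact hat ⟨he, h0, fun r h1 h2 h3 => hcon r h1 h2 h3⟩
    have her : e * r = r := mul_eq_of_le he hr hle
    have hre : r * (e - r) = 0 := by rw [mul_sub, mul_comm r e, her, hr, sub_self]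
    have hd : (e - r) * (e - r) = e - r := by
      rw [sub_mul, hre, sub_zero, mul_sub, he, her]
    have h1 := one_le_mul_norm_of_idempotent hC hd (sub_ne_zero.2 hne.symm)
    have h2 : ‖e‖ ^ 2 = ‖r‖ ^ 2 + ‖e - r‖ ^ 2 := by
      rw [← inner_one_of_idempotent he, ← inner_one_of_idempotent hr,
        ← inner_one_of_idempotent hd, ← inner_add_left, add_sub_cancel]
    obtain ⟨r', hat', hr'⟩ := ih hr hr0 (by
      push_cast at hN
      rw [h2] at hN
      nlinarith)
    refine ⟨r', hat', ?_⟩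
    have h3 := peirce_zero_mul_one hr hre hr'
    rwa [sub_mul, hr', sub_eq_zero] at h3

theorem sum_idempotent {n : ℕ} {p : Fin n → E} (hp : ∀ i, p i * p i = p i)
    (ho : ∀ i j, i ≠ j → p i * p j = 0) : (∑ i, p i) * ∑ i, p i = ∑ i, p i := by
  rw [Finset.sum_mul]
  refine Finset.sum_congr rfl fun i _ => ?_
  rw [Finset.mul_sum, Finset.sum_eq_single i (fun j _ hj => ho i j hj.symm) (by simp), hp]

theorem card_orthogonal_le {C : ℝ} (hC : ∀ a b : E, ‖a * b‖ ≤ C * ‖a‖ * ‖b‖) {n : ℕ}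
    {p : Fin n → E} (hp : ∀ i, p i * p i = p i) (h0 : ∀ i, p i ≠ 0)
    (ho : ∀ i j, i ≠ j → p i * p j = 0) : (n : ℝ) ≤ C ^ 2 * ‖(1 : E)‖ ^ 2 := by
  have hc := sum_idempotent hp ho
  have h1 := inner_one_of_idempotent hc
  have h2 : ‖∑ i, p i‖ ≤ ‖(1 : E)‖ := by
    have := real_inner_le_norm (∑ i, p i) 1
    rw [h1] at this
    by_contra! h
    nlinarith [norm_nonneg (1 : E)]
  have h3 : ‖∑ i, p i‖ ^ 2 = ∑ i, ‖p i‖ ^ 2 := by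
    rw [← h1, sum_inner]
    exact Finset.sum_congr rfl fun i _ => inner_one_of_idempotent (hp i)
  calc (n : ℝ) = ∑ _i : Fin n, (1 : ℝ) := by simp
    _ ≤ ∑ i, C ^ 2 * ‖p i‖ ^ 2 := Finset.sum_le_sum fun i _ => by
      rw [← mul_pow]
      exact one_le_pow₀ (one_le_mul_norm_of_idempotent hC (hp i) (h0 i))
    _ = C ^ 2 * ‖∑ i, p i‖ ^ 2 := by rw [h3, Finset.mul_sum]
    _ ≤ _ := by gcongr

/-- The last clause keeps the new atom orthogonal to those already split off. -/
theorem exists_atomic_eigenvector {x : E} (hx : x ≠ 0) :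
    ∃ (t : ℝ) (r : E), t ≠ 0 ∧ IsAtomic r ∧ x * r = t • r ∧
      ∀ p : E, p * p = p → p * x = 0 → p * r = 0 := by
  obtain ⟨t, e, ht, he0, he, hxe, hp⟩ := exists_idempotent_eigenvector hx
  obtain ⟨r, hr, her⟩ := exists_atomic_below he he0
  refine ⟨t, r, ht, hr, ?_, fun p h1 h2 => ?_⟩
  · have h1 : e * (x - t • e) = 0 := by
      rw [mul_sub, mul_smul_comm, he, mul_comm, hxe, sub_self]
    have h2 := peirce_zero_mul_one he h1 her
    rwa [sub_mul, smul_mul_assoc, her, sub_eq_zero] at h2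
  · exact peirce_zero_mul_one he (by rw [mul_comm, hp p h1 h2]) her

/-- The spectral theorem: every element is a finite linear combination, with nonzero
coefficients, of pairwise orthogonal atomic idempotents. -/
theorem exists_spectral_decomposition (a : E) :
    ∃ (n : ℕ) (t : Fin n → ℝ) (p : Fin n → E),
      (∀ i, t i ≠ 0) ∧ (∀ i, IsAtomic (p i)) ∧ (∀ i j, i ≠ j → p i * p j = 0) ∧
        a = ∑ i, t i • p i := by
  by_contra hcon
  -- Without a finite decomposition the remainder `x` never vanishes, so orthogonal atoms can be
  -- peeled off indefinitely, against `card_orthogonal_le`.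
  have key : ∀ n : ℕ, ∃ (t : Fin n → ℝ) (p : Fin n → E) (x : E),
      (∀ i, t i ≠ 0) ∧ (∀ i, IsAtomic (p i)) ∧ (∀ i j, i ≠ j → p i * p j = 0) ∧
        (∀ i, p i * x = 0) ∧ a = (∑ i, t i • p i) + x := by
    intro n
    induction n with
    | zero => exact ⟨Fin.elim0, Fin.elim0, a, by simp⟩
    | succ n ih =>
      obtain ⟨t, p, x, ht, hp, ho, hx, ha⟩ := ih
      have hx0 : x ≠ 0 := by
        rintro rfl
        exact hcon ⟨n, t, p, ht, hp, ho, by simpa using ha⟩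
      obtain ⟨s, r, hs, hr, hxr, hpr⟩ := exists_atomic_eigenvector hx0
      have hpr' : ∀ i, p i * r = 0 := fun i => hpr _ (hp i).1 (hx i)
      refine ⟨Fin.snoc t s, Fin.snoc p r, x - s • r, ?_, ?_, ?_, ?_, ?_⟩
      · refine Fin.lastCases (by simpa using hs) fun i => by simpa using ht i
      · refine Fin.lastCases (by simpa using hr) fun i => by simpa using hp i
      · intro i j
        induction i using Fin.lastCases with
        | last =>
          induction j using Fin.lastCases with
          | last => simp
          | cast j => simp [mul_comm r, hpr']
        | cast i =>
          induction j using Fin.lastCases with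
          | last => simp [hpr']
          | cast j => simpa using ho i j
      · refine Fin.lastCases ?_ fun i => ?_
        · simp only [Fin.snoc_last, mul_sub, mul_smul_comm, hr.1, mul_comm r x, hxr, sub_self]
        · simp only [Fin.snoc_castSucc, mul_sub, mul_smul_comm, hpr', hx, smul_zero, sub_self]
      · simp [Fin.sum_univ_castSucc, ha]
  obtain ⟨C, -, hC⟩ := exists_norm_mul_le E
  obtain ⟨N, hN⟩ := exists_nat_gt (C ^ 2 * ‖(1 : E)‖ ^ 2)
  obtain ⟨t, p, x, -, hp, ho, -, -⟩ := key N
  exact hN.not_ge (card_orthogonal_le hC (fun i => (hp i).1) (fun i => (hp i).2.1) ho)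

/-! ### Self-duality of the positive cone -/

theorem inner_sum_orthogonal {n : ℕ} {t : Fin n → ℝ} {p : Fin n → E}
    (hp : ∀ i, p i * p i = p i) (ho : ∀ i j, i ≠ j → p i * p j = 0) (i : Fin n) :
    inner ℝ (p i) (∑ j, t j • p j) = t i * ‖p i‖ ^ 2 := by
  rw [inner_sum, Finset.sum_eq_single i, real_inner_smul_right, real_inner_self_eq_norm_sq]
  · intro j _ hj
    rw [real_inner_smul_right]
    nth_rw 1 [← hp i]
    rw [inner_mul_left, ho i j hj.symm, inner_zero_right, mul_zero]
  · simp

theorem exists_pos_decomposition {a : E}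
    (ha : ∀ r : E, r * r = r → 0 ≤ inner ℝ r a) :
    ∃ (n : ℕ) (t : Fin n → ℝ) (p : Fin n → E),
      (∀ i, 0 < t i) ∧ (∀ i, IsAtomic (p i)) ∧ (∀ i j, i ≠ j → p i * p j = 0) ∧
        a = ∑ i, t i • p i := by
  obtain ⟨n, t, p, ht, hp, ho, rfl⟩ := exists_spectral_decomposition a
  refine ⟨n, t, p, fun i => (ht i).symm.lt_of_le ?_, hp, ho, rfl⟩
  have h := ha (p i) (hp i).1
  rw [inner_sum_orthogonal (fun i => (hp i).1) ho] at h
  exact nonneg_of_mul_nonneg_left h (by have := norm_pos_iff.2 (hp i).2.1; positivity)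

theorem isPositive_iff {a : E} : IsPositive a ↔ ∀ r : E, r * r = r → 0 ≤ inner ℝ r a := by
  refine ⟨fun h r hr => inner_idempotent_nonneg hr h, fun h => ?_⟩
  obtain ⟨n, t, p, ht, hp, ho, rfl⟩ := exists_pos_decomposition h
  refine ⟨∑ i, √(t i) • p i, ?_⟩
  rw [Finset.sum_mul]
  refine Finset.sum_congr rfl fun i _ => ?_
  rw [Finset.mul_sum, Finset.sum_eq_single i, smul_mul_assoc, mul_smul_comm, (hp i).1, smul_smul,
    Real.mul_self_sqrt (ht i).le]
  · intro j _ hj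
    rw [smul_mul_assoc, mul_smul_comm, ho i j hj.symm, smul_zero, smul_zero]
  · simp

theorem inner_nonneg_of_isPositive {a b : E} (ha : IsPositive a) (hb : IsPositive b) :
    0 ≤ inner ℝ a b := by
  obtain ⟨n, t, p, ht, hp, ho, rfl⟩ := exists_pos_decomposition (isPositive_iff.1 ha)
  rw [sum_inner]
  refine Finset.sum_nonneg fun i _ => ?_
  rw [real_inner_smul_left]
  exact mul_nonneg (ht i).le (inner_idempotent_nonneg (hp i).1 hb)

theorem isCeil_ceil {a : E} (ha : IsPositive a) : IsCeil a (ceil a) := by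
  have h : ∃ c : E, IsCeil a c := by
    obtain ⟨n, t, p, ht, hp, ho, h⟩ := exists_pos_decomposition (isPositive_iff.1 ha)
    exact ⟨_, n, t, p, ht, hp, ho, h, rfl⟩
  rw [ceil, dif_pos h]
  exact h.choose_spec

theorem isPositive_of_idempotent {p : E} (hp : p * p = p) : IsPositive p := ⟨p, hp.symm⟩

/-! ### The standard corner -/

theorem Q_mem_peirceOne (p : Idempotent E) (x : E) : Q p.1 x ∈ peirceOne p :=
  LinearMap.mem_range_self _ x

theorem Q_of_mem_peirceOne {p : Idempotent E} {x : E} (hx : x ∈ peirceOne p) : Q p.1 x = x := by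
  have h := mem_peirceOne_iff.1 hx
  rw [Q_apply, p.2, h, h, two_smul, add_sub_cancel_right]

theorem Q_one (p : Idempotent E) : Q p.1 1 = p.1 := by
  rw [Q_apply, mul_one_eq, mul_one_eq, p.2, two_smul, add_sub_cancel_right]

theorem inner_Q (a x y : E) : inner ℝ (Q a x) y = inner ℝ x (Q a y) := by
  simp only [Q_apply, inner_sub_left, inner_sub_right, real_inner_smul_left,
    real_inner_smul_right, inner_mul_left]

theorem coe_standardCorner (q x : E) : (standardCorner q x : E) = Q (floor q).1 x :=
  congrArg Subtype.val
    (Submodule.orthogonalProjectionOnto_mem_subspace_eq_self ⟨_, Q_mem_peirceOne (floor q) x⟩)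

theorem isPositive_coe {p : Idempotent E} {x : peirceOne p} (hx : IsPositive x) :
    IsPositive (x : E) := by
  obtain ⟨b, rfl⟩ := hx
  exact ⟨b, rfl⟩

theorem standardCorner_isPSU (q : E) : IsPSU (standardCorner q) := by
  constructor
  · intro a ha
    refine isPositive_iff.2 fun r hr => ?_
    have h : (r : E) * r = r := congrArg Subtype.val hr
    -- Symmetry moves `Q_p` onto `r`, which it fixes.
    rw [Submodule.coe_inner, coe_standardCorner, ← inner_Q, Q_of_mem_peirceOne r.2]
    exact inner_idempotent_nonneg h ha
  · refine ⟨0, ?_⟩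
    rw [mul_zero, sub_eq_zero]
    refine Subtype.ext ?_
    exact ((coe_standardCorner q 1).trans (Q_one _)).symm

/-! ### Positive maps that vanish on `1 - q` -/

variable {F : Type*} [NormedAddCommGroup F] [InnerProductSpace ℝ F] [EuclideanJordanAlgebra F]

theorem eq_zero_of_sum_eq_zero {n : ℕ} {t : Fin n → ℝ} {a : Fin n → E} (ht : ∀ i, 0 < t i)
    (ha : ∀ i, IsPositive (a i)) (h : ∑ i, t i • a i = 0) (i : Fin n) : a i = 0 := by
  choose b hb using ha
  have h1 : ∑ i, t i * ‖b i‖ ^ 2 = 0 := by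
    have := congrArg (fun x => inner ℝ x (1 : E)) h
    simpa only [sum_inner, real_inner_smul_left, hb, inner_mul_self_one, inner_zero_left] using this
  have h2 := (Finset.sum_eq_zero_iff_of_nonneg fun i _ =>
    mul_nonneg (ht i).le (sq_nonneg ‖b i‖)).1 h1 i (Finset.mem_univ i)
  have h3 : b i = 0 := by simpa [(ht i).ne'] using h2
  rw [hb, h3, mul_zero]

/-- Paired with a square, `g ((y + t • c)²)` is nonnegative and affine in `t`, since the quadratic
term is killed; its slope must vanish. -/
theorem map_mul_eq_zero {g : E →ₗ[ℝ] F} (hg : ∀ a : E, IsPositive a → IsPositive (g a)) {c : E}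
    (hc : g (c * c) = 0) (y : E) : g (c * y) = 0 := by
  have key : ∀ w : F, inner ℝ (g (c * y)) (w * w) = 0 := fun w => by
    have h : ∀ t : ℝ, 0 ≤ inner ℝ (g (y * y)) (w * w) + 2 * t * inner ℝ (g (c * y)) (w * w) := by
      intro t
      have h1 := inner_nonneg_of_isPositive (hg _ ⟨y + t • c, rfl⟩) ⟨w, rfl⟩
      have h2 : (y + t • c) * (y + t • c) = y * y + (2 * t) • (c * y) + (t * t) • (c * c) := by
        rw [add_mul, mul_add, mul_add, smul_mul_assoc, smul_mul_assoc, mul_smul_comm,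
          mul_smul_comm, smul_smul, mul_comm y c, two_mul, add_smul]
        abel
      rwa [h2, map_add, map_add, map_smul, map_smul, hc, smul_zero, add_zero, inner_add_left,
        real_inner_smul_left] at h1
    by_contra hne
    -- This `t` makes the affine function equal to `-1`.
    have h3 := h (-(inner ℝ (g (y * y)) (w * w) + 1) / (2 * inner ℝ (g (c * y)) (w * w)))
    field_simp at h3
    linarith
  set z := g (c * y)
  -- Polarisation: `z` is orthogonal to `(z + 1)²`, `z²` and `1`, hence to itself.
  have h1 := key (z + 1)
  rw [add_mul, mul_add, mul_add, one_mul_eq, mul_one_eq, mul_one_eq, inner_add_right,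
    inner_add_right, inner_add_right, key, real_inner_self_eq_norm_sq] at h1
  have h2 := key 1
  rw [mul_one_eq] at h2
  rw [h2] at h1
  have : ‖z‖ ^ 2 = 0 := by linarith
  simpa using this

theorem Q_floor_one_sub {q : E} (h : IsCeil (1 - q) (ceil (1 - q))) :
    Q (floor q).1 (1 - q) = 0 := by
  obtain ⟨n, t, p, ht, hp, ho, h1, h2⟩ := h
  rw [h1, map_sum]
  refine Finset.sum_eq_zero fun i _ => ?_
  have h3 : (floor q).1 * p i = 0 := by
    change (1 - ceil (1 - q)) * p i = 0
    rw [h2, sub_mul, one_mul_eq, Finset.sum_mul,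
      Finset.sum_eq_single i (fun j _ hj => ho j i hj) (by simp), (hp i).1, sub_self]
  rw [map_smul, Q_apply, (floor q).2, h3, mul_zero, smul_zero, sub_zero, smul_zero]

theorem map_Q_floor {q : E} (h : IsCeil (1 - q) (ceil (1 - q))) {g : E →ₗ[ℝ] F}
    (hg : ∀ a : E, IsPositive a → IsPositive (g a)) (hgq : g 1 = g q) (x : E) :
    g (Q (floor q).1 x) = g x := by
  have hc : g (ceil (1 - q)) = 0 := by
    obtain ⟨n, t, p, ht, hp, ho, h1, h2⟩ := h
    have h3 : ∑ i, t i • g (p i) = 0 := by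
      simp only [← map_smul, ← map_sum]
      rw [← h1, map_sub, hgq, sub_self]
    rw [h2, map_sum]
    exact Finset.sum_eq_zero fun i _ => eq_zero_of_sum_eq_zero ht
      (fun i => hg _ (isPositive_of_idempotent (hp i).1)) h3 i
  have hp : ∀ y, g ((floor q).1 * y) = g y := fun y => by
    change g ((1 - ceil (1 - q)) * y) = g y
    rw [sub_mul, one_mul_eq, map_sub, map_mul_eq_zero hg (by rwa [ceil_idempotent]), sub_zero]
  rw [Q_apply, (floor q).2, map_sub, map_smul, hp, hp, two_smul, add_sub_cancel_right]

end Spectral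
end EuclideanJordanAlgebra

theorem mainTheorem5 {E : Type u} [NormedAddCommGroup E] [InnerProductSpace ℝ E]
    [EuclideanJordanAlgebra E] (q : E) (hq : EuclideanJordanAlgebra.IsEffect q) :
    EuclideanJordanAlgebra.IsCeil (1 - q) (EuclideanJordanAlgebra.ceil (1 - q)) ∧
      EuclideanJordanAlgebra.IsCorner.{u, u, w} q (EuclideanJordanAlgebra.standardCorner q) := by
  have hceil := EuclideanJordanAlgebra.isCeil_ceil hq.2
  have hπ : ∀ x : EuclideanJordanAlgebra.peirceOne (EuclideanJordanAlgebra.floor q),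
      EuclideanJordanAlgebra.standardCorner q x.1 = x := fun x =>
    Subtype.ext ((EuclideanJordanAlgebra.coe_standardCorner q x.1).trans
      (EuclideanJordanAlgebra.Q_of_mem_peirceOne x.2))
  refine ⟨hceil, EuclideanJordanAlgebra.standardCorner_isPSU q, ?_, ?_⟩
  · refine Subtype.ext ?_
    rw [EuclideanJordanAlgebra.coe_standardCorner, EuclideanJordanAlgebra.coe_standardCorner,
      ← sub_eq_zero, ← map_sub, EuclideanJordanAlgebra.Q_floor_one_sub hceil]
  · intro F _ _ _ g hg hgq
    have hgQ := EuclideanJordanAlgebra.map_Q_floor hceil hg.1 hgq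
    have hcomp : (g ∘ₗ (EuclideanJordanAlgebra.peirceOne
        (EuclideanJordanAlgebra.floor q)).subtype) ∘ₗ EuclideanJordanAlgebra.standardCorner q
          = g := by
      refine LinearMap.ext fun x => ?_
      rw [LinearMap.comp_apply, LinearMap.comp_apply, Submodule.subtype_apply,
        EuclideanJordanAlgebra.coe_standardCorner, hgQ]
    -- `hcomp` fixes the witness as the restriction of `g`; it is subunital because `g p = g (Q_p 1)
    -- = g 1`.
    refine ⟨_, ⟨⟨fun a ha => hg.1 _ (EuclideanJordanAlgebra.isPositive_coe ha), ?_⟩, hcomp⟩, ?_⟩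
    · change EuclideanJordanAlgebra.Le (g (EuclideanJordanAlgebra.floor q).1) 1
      rw [← EuclideanJordanAlgebra.Q_one, hgQ]
      exact hg.2
    · rintro k ⟨-, hk⟩
      refine LinearMap.ext fun x => ?_
      rw [← hπ x, ← LinearMap.comp_apply, ← LinearMap.comp_apply, hk, hcomp]
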